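/- Let $G$ be a finite simple graph with $m$ edges that is not a complete graph (in particular $G$ has at least two vertices). Let $\omega(G)$ be the clique number of $G$, that is, the largest number of vertices in a clique of $G$, and let $\lambda_1 \ge \lambda_2 \ge \dots \ge \lambda_n$ be the eigenvalues of the adjacency matrix of $G$, listed with multiplicity. Then \[ \lambda_1^2 + \lambda_2^2 \le \left(1 - \frac{1}{\omega(G) + 50\,\omega(G)^{5/6}}\right) 2m . \] -/

import Mathlib

namespace SimpleGraph

/-- A graph that is not complete has at least two vertices. -/
theorem one_lt_card_of_ne_top {V : Type*} [Fintype V] {G : SimpleGraph V} (hG : G ≠ ⊤) :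
    1 < Fintype.card V := by
  by_contra h
  have : Subsingleton V := Fintype.card_le_one_iff_subsingleton.mp (not_lt.mp h)
  exact hG (Subsingleton.elim G ⊤)

/-- The eigenvalues of the real adjacency matrix of `G`, with multiplicity, in non-increasing
order; the index is zero-based, so that `λ₁` has index `0` and `λ₂` has index `1`. -/
noncomputable def adjEigenvalue {V : Type*} [Fintype V] [DecidableEq V] (G : SimpleGraph V)
    [DecidableRel G.Adj] : Fin (Fintype.card V) → ℝ :=
  (G.isHermitian_adjMatrix ℝ).eigenvalues₀

end SimpleGraph

/-
Scale two orthonormal eigenvectors by the square roots of their eigenvalues and pair their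
coordinates: every vertex `i` gets a vector `z i` in the plane such that the sum of all
`⟪z i, z j⟫ ^ 2` is `λ₁ ^ 2 + λ₂ ^ 2`, and the inner products over adjacent pairs have the same sum.
By Cauchy–Schwarz, the bound holds as soon as a proportion `1 / W` of the sum of squares comes from
nonadjacent pairs or negative inner products.

If the coordinates of all `z i` are nonnegative, `⟪z i, z j⟫ ^ 2` is a sum of terms `w i * w j` with
`w ≥ 0`, and the Motzkin–Straus inequality gives this with `W = ω`. In general, either the negative
inner products already contribute enough, or few pairs of vectors are obtuse; then nearly all of the
weight lies, after a rotation, in a quadrant, up to a small angular error `h`, and the loss is of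
order `h` times the sum of squares. Balancing the two cases leads to `h = ω ^ (-1 / 6)`, which is
where the exponent `5 / 6` comes from.
-/

namespace BollobasNikiforov

open Finset
open scoped Matrix

section MotzkinStraus

variable {V : Type*} [Fintype V] (G : SimpleGraph V) [DecidableRel G.Adj]

theorem sum_not_adj_mul (w : V → ℝ) :
    ∑ p : V × V with ¬ G.Adj p.1 p.2, w p.1 * w p.2 =
      ∑ i, w i * ∑ j with ¬ G.Adj i j, w j := by
  simp only [sum_filter, Fintype.sum_prod_type, mul_sum, mul_ite, mul_zero]

theorem add_sq_le_succ_mul {n r y F : ℝ} (hn : 0 ≤ n) (hF : 0 ≤ F) (hy : y ^ 2 ≤ n * F) :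
    (r + y) ^ 2 ≤ (n + 1) * (r ^ 2 + F) := by
  rcases hn.eq_or_lt with rfl | hn
  · obtain rfl : y = 0 := by nlinarith
    linarith
  · have h : 2 * r * y ≤ n * r ^ 2 + F := by
      refine le_of_mul_le_mul_left ?_ hn
      linarith [sq_nonneg (n * r - y)]
    linarith

variable {G} in
theorem sq_add_sum_not_adj_neighbors_le {w : V → ℝ} (hw : ∀ i, 0 ≤ w i) {v : V}
    (hv : ∀ u, w u ≠ 0 → ∑ j with ¬ G.Adj v j, w j ≤ ∑ j with ¬ G.Adj u j, w j) :
    (∑ j with ¬ G.Adj v j, w j) ^ 2 +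
        ∑ p : V × V with ¬ G.Adj p.1 p.2,
          (if G.Adj v p.1 then w p.1 else 0) * (if G.Adj v p.2 then w p.2 else 0) ≤
      ∑ p : V × V with ¬ G.Adj p.1 p.2, w p.1 * w p.2 := by
  rw [sum_not_adj_mul, sum_not_adj_mul G fun i => if G.Adj v i then w i else 0, sq, sum_mul,
    sum_filter, ← sum_add_distrib]
  refine sum_le_sum fun u _ => ?_
  by_cases huv : G.Adj v u
  · simp only [huv, not_true_eq_false, if_false, if_true, zero_add]
    refine mul_le_mul_of_nonneg_left (sum_le_sum fun j _ => ?_) (hw u)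
    split_ifs
    exacts [le_rfl, hw j]
  · simp only [huv, not_false_eq_true, if_false, if_true, zero_mul, add_zero]
    by_cases hu : w u = 0
    · simp [hu]
    · exact mul_le_mul_of_nonneg_left (hv u hu) (hw u)

variable {G} in
theorem sq_sum_le_mul_sum_not_adj {n : ℕ} {w : V → ℝ} (hw : ∀ i, 0 ≤ w i)
    (hn : ∀ K : Finset V, G.IsClique (K : Set V) → (∀ i ∈ K, w i ≠ 0) → #K ≤ n) :
    (∑ i, w i) ^ 2 ≤ n * ∑ p : V × V with ¬ G.Adj p.1 p.2, w p.1 * w p.2 := by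
  classical
  induction n generalizing w with
  | zero =>
    have hw0 (i : V) : w i = 0 := by
      by_contra hi
      simpa using hn {i} (by simp) (by simpa using hi)
    simp [hw0]
  | succ n ih =>
    rcases ({i | w i ≠ 0} : Finset V).eq_empty_or_nonempty with hemp | hne
    · have hw0 (i : V) : w i = 0 := by simpa using filter_eq_empty_iff.mp hemp (mem_univ i)
      simp [hw0]
    -- Erdős's proof of Turán's theorem: pass to the neighbours of a vertex of maximal degree.
    obtain ⟨v, hv, hmin⟩ := exists_min_image _ (fun i => ∑ j with ¬ G.Adj i j, w j) hne
    set w' : V → ℝ := fun i => if G.Adj v i then w i else 0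
    have hw' (i : V) : 0 ≤ w' i := by
      simp only [w']
      split_ifs
      exacts [hw i, le_rfl]
    have hclique (K : Finset V) (hK : G.IsClique (K : Set V)) (hKw : ∀ i ∈ K, w' i ≠ 0) :
        #K ≤ n := by
      have hadj : ∀ i ∈ K, G.Adj v i ∧ w i ≠ 0 := by simpa [w'] using hKw
      have hvK : v ∉ K := fun h => G.irrefl (hadj v h).1
      have := hn (insert v K) (by simpa using hK.insert fun i hi _ => (hadj i hi).1) (by
        rw [forall_mem_insert]
        exact ⟨(mem_filter.mp hv).2, fun i hi => (hadj i hi).2⟩)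
      rwa [card_insert_of_notMem hvK, Nat.add_le_add_iff_right] at this
    have hsum : ∑ i, w i = ∑ j with ¬ G.Adj v j, w j + ∑ i, w' i := by
      rw [← sum_filter_add_sum_filter_not univ (G.Adj v) w, add_comm, sum_filter (G.Adj v)]
    rw [hsum, Nat.cast_add_one]
    refine (add_sq_le_succ_mul n.cast_nonneg ?_ (ih hw' hclique)).trans ?_
    · exact sum_nonneg fun p _ => mul_nonneg (hw' _) (hw' _)
    · exact mul_le_mul_of_nonneg_left
        (sq_add_sum_not_adj_neighbors_le hw fun u hu => hmin u (by simpa using hu)) (by positivity)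

theorem sq_sum_le_cliqueNum_mul {w : V → ℝ} (hw : ∀ i, 0 ≤ w i) :
    (∑ i, w i) ^ 2 ≤ G.cliqueNum * ∑ p : V × V with ¬ G.Adj p.1 p.2, w p.1 * w p.2 :=
  sq_sum_le_mul_sum_not_adj hw fun _ hK _ => hK.card_le_cliqueNum

theorem sum_sum_mul_le_cliqueNum_mul {κ : Type*} [Fintype κ] {w : κ → V → ℝ}
    (hw : ∀ k i, 0 ≤ w k i) :
    ∑ p : V × V, ∑ k, w k p.1 * w k p.2 ≤
      G.cliqueNum * ∑ p : V × V with ¬ G.Adj p.1 p.2, ∑ k, w k p.1 * w k p.2 := by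
  rw [sum_comm, sum_comm (s := {p : V × V | ¬ G.Adj p.1 p.2}), mul_sum]
  refine sum_le_sum fun k _ => ?_
  rw [← univ_product_univ, sum_product, ← sum_mul_sum, ← sq, univ_product_univ]
  exact sq_sum_le_cliqueNum_mul G (hw k)

theorem sum_sq_dotProduct_le_cliqueNum_mul {ι : Type*} [Fintype ι] {x : V → ι → ℝ}
    (hx : ∀ i k, 0 ≤ x i k) :
    ∑ p : V × V, (x p.1 ⬝ᵥ x p.2) ^ 2 ≤
      G.cliqueNum * ∑ p : V × V with ¬ G.Adj p.1 p.2, (x p.1 ⬝ᵥ x p.2) ^ 2 := by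
  have hsq (p : V × V) : (x p.1 ⬝ᵥ x p.2) ^ 2 =
      ∑ k : ι × ι, (x p.1 k.1 * x p.1 k.2) * (x p.2 k.1 * x p.2 k.2) := by
    simp only [dotProduct, sq, sum_mul_sum, Fintype.sum_prod_type, mul_mul_mul_comm]
  simp only [hsq]
  exact sum_sum_mul_le_cliqueNum_mul G (w := fun (k : ι × ι) i => x i k.1 * x i k.2)
    fun k i => mul_nonneg (hx i k.1) (hx i k.2)

end MotzkinStraus

section Plane

variable {V : Type*} [Fintype V]

theorem real_inner_eq_re_mul_add_im_mul (z w : ℂ) :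
    inner ℝ z w = z.re * w.re + z.im * w.im := by
  rw [Complex.inner, Complex.mul_re, Complex.conj_re, Complex.conj_im]
  ring

theorem real_inner_eq_norm_mul_cos_arg_sub (z w : ℂ) :
    inner ℝ z w = ‖z‖ * ‖w‖ * ((z.arg : Real.Angle) - w.arg).cos := by
  calc inner ℝ z w = z.re * w.re + z.im * w.im := real_inner_eq_re_mul_add_im_mul z w
    _ = ‖z‖ * Real.cos z.arg * (‖w‖ * Real.cos w.arg) +
          ‖z‖ * Real.sin z.arg * (‖w‖ * Real.sin w.arg) := by
      simp only [Complex.norm_mul_cos_arg, Complex.norm_mul_sin_arg]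
    _ = ‖z‖ * ‖w‖ * ((z.arg : Real.Angle) - w.arg).cos := by
      rw [← Real.Angle.coe_sub, Real.Angle.cos_coe, Real.cos_sub]
      ring

theorem sum_mul_sq_inner (ε : V → ℝ) (z : V → ℂ) :
    ∑ p : V × V, ε p.1 * ε p.2 * inner ℝ (z p.1) (z p.2) ^ 2 =
      (∑ i, ε i * (z i).re ^ 2) ^ 2 + (∑ i, ε i * (z i).im ^ 2) ^ 2 +
        2 * (∑ i, ε i * ((z i).re * (z i).im)) ^ 2 := by
  have h (f : V → ℝ) : (∑ i, f i) ^ 2 = ∑ p : V × V, f p.1 * f p.2 := by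
    rw [sq, sum_mul_sum, Fintype.sum_prod_type]
  simp only [h, mul_sum, ← sum_add_distrib, real_inner_eq_re_mul_add_im_mul]
  exact sum_congr rfl fun p _ => by ring

theorem sum_sq_inner (z : V → ℂ) :
    ∑ p : V × V, inner ℝ (z p.1) (z p.2) ^ 2 =
      (∑ i, (z i).re ^ 2) ^ 2 + (∑ i, (z i).im ^ 2) ^ 2 +
        2 * (∑ i, (z i).re * (z i).im) ^ 2 := by
  simpa using sum_mul_sq_inner (fun _ => 1) z

theorem sq_sum_norm_sq_le (z : V → ℂ) :
    (∑ i, ‖z i‖ ^ 2) ^ 2 ≤ 2 * ∑ p : V × V, inner ℝ (z p.1) (z p.2) ^ 2 := by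
  simp only [sum_sq_inner, Complex.sq_norm, Complex.normSq_apply, ← sq, sum_add_distrib]
  linarith [sq_nonneg (∑ i, (z i).re ^ 2 - ∑ i, (z i).im ^ 2),
    sq_nonneg (∑ i, (z i).re * (z i).im)]

theorem sq_inner_le (z w : ℂ) : inner ℝ z w ^ 2 ≤ ‖z‖ ^ 2 * ‖w‖ ^ 2 := by
  rw [← mul_pow, sq_le_sq, abs_of_nonneg (by positivity : 0 ≤ ‖z‖ * ‖w‖)]
  exact abs_real_inner_le_norm z w

theorem sum_sq_inner_le (z : V → ℂ) :
    ∑ p : V × V, inner ℝ (z p.1) (z p.2) ^ 2 ≤ (∑ i, ‖z i‖ ^ 2) ^ 2 := by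
  rw [sq (∑ i, _), sum_mul_sum, Fintype.sum_prod_type]
  exact sum_le_sum fun i _ => sum_le_sum fun j _ => sq_inner_le _ _

theorem sq_abs_mul_add_eq_sq_inner {z w : ℂ} (h : 0 ≤ (z.re * z.im) * (w.re * w.im)) :
    (|z.re| * |w.re| + |z.im| * |w.im|) ^ 2 = inner ℝ z w ^ 2 := by
  rw [real_inner_eq_re_mul_add_im_mul, ← abs_mul, ← abs_mul, sq_eq_sq_iff_abs_eq_abs,
    ← abs_add_eq_add_abs_iff _ _ |>.mpr, abs_abs]
  rw [mul_mul_mul_comm] at h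
  exact mul_nonneg_iff.mp h

/-- The absolute values of the coordinates of `z`, placed in one of two orthogonal planes according
to the sign of `z.re * z.im`, that is, to the pair of opposite quadrants containing `z`. -/
noncomputable def quadrantSplit (z : ℂ) (k : Bool × Bool) : ℝ :=
  if k.1 = decide (0 ≤ z.re * z.im) then |bif k.2 then z.re else z.im| else 0

theorem quadrantSplit_nonneg (z : ℂ) (k : Bool × Bool) : 0 ≤ quadrantSplit z k := by
  unfold quadrantSplit
  split_ifs
  exacts [abs_nonneg _, le_rfl]

theorem quadrantSplit_dotProduct_sq (z w : ℂ) :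
    (quadrantSplit z ⬝ᵥ quadrantSplit w) ^ 2 =
      if (0 ≤ z.re * z.im ↔ 0 ≤ w.re * w.im) then inner ℝ z w ^ 2 else 0 := by
  have hdot : quadrantSplit z ⬝ᵥ quadrantSplit w =
      if (0 ≤ z.re * z.im ↔ 0 ≤ w.re * w.im) then |z.re| * |w.re| + |z.im| * |w.im| else 0 := by
    by_cases hz : 0 ≤ z.re * z.im <;> by_cases hw : 0 ≤ w.re * w.im <;>
      simp [quadrantSplit, hz, hw, dotProduct, Fintype.sum_prod_type]
  rw [hdot]
  split_ifs with h
  · refine sq_abs_mul_add_eq_sq_inner ?_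
    by_cases hz : 0 ≤ z.re * z.im
    · exact mul_nonneg hz (h.mp hz)
    · exact mul_nonneg_of_nonpos_of_nonpos (not_le.mp hz).le (not_le.mp (mt h.mpr hz)).le
  · exact zero_pow two_ne_zero

/- The entrywise square of a Gram matrix is positive semidefinite, so it is dominated by twice the
sum of its two diagonal blocks when the vectors are sorted by the pair of opposite quadrants
containing them. -/
theorem sum_sq_inner_le_two_mul_cliqueNum_mul (G : SimpleGraph V) [DecidableRel G.Adj]
    (z : V → ℂ) :
    ∑ p : V × V, inner ℝ (z p.1) (z p.2) ^ 2 ≤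
      2 * G.cliqueNum *
        ∑ p : V × V with ¬ G.Adj p.1 p.2, inner ℝ (z p.1) (z p.2) ^ 2 := by
  set x : V → Bool × Bool → ℝ := fun i => quadrantSplit (z i)
  set ε : V → ℝ := fun i => if 0 ≤ (z i).re * (z i).im then 1 else -1
  have hε (i j : V) : (1 + ε i * ε j) * inner ℝ (z i) (z j) ^ 2 = 2 * (x i ⬝ᵥ x j) ^ 2 := by
    rw [quadrantSplit_dotProduct_sq]
    by_cases hi : 0 ≤ (z i).re * (z i).im <;> by_cases hj : 0 ≤ (z j).re * (z j).im <;>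
      norm_num [ε, hi, hj, -mul_eq_zero, -mul_eq_mul_right_iff]
  have hpos : 0 ≤ ∑ p : V × V, ε p.1 * ε p.2 * inner ℝ (z p.1) (z p.2) ^ 2 := by
    rw [sum_mul_sq_inner]
    positivity
  calc ∑ p : V × V, inner ℝ (z p.1) (z p.2) ^ 2
      ≤ ∑ p : V × V, (1 + ε p.1 * ε p.2) * inner ℝ (z p.1) (z p.2) ^ 2 := by
        simp only [add_mul, one_mul, sum_add_distrib]
        linarith
    _ = 2 * ∑ p : V × V, (x p.1 ⬝ᵥ x p.2) ^ 2 := by simp only [hε, mul_sum]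
    _ ≤ 2 * (G.cliqueNum * ∑ p : V × V with ¬ G.Adj p.1 p.2, (x p.1 ⬝ᵥ x p.2) ^ 2) := by
        gcongr
        exact sum_sq_dotProduct_le_cliqueNum_mul G fun i => quadrantSplit_nonneg (z i)
    _ ≤ 2 * (G.cliqueNum * ∑ p : V × V with ¬ G.Adj p.1 p.2, inner ℝ (z p.1) (z p.2) ^ 2) := by
        gcongr ?_ * (?_ * ?_)
        refine sum_le_sum fun p _ => ?_
        rw [quadrantSplit_dotProduct_sq]
        split_ifs
        exacts [le_rfl, sq_nonneg _]
    _ = _ := by ring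

end Plane

section WideQuadrant

/-- The angles in the quadrant `[0, π / 2]`, widened beyond `π / 2` until the cosine is `-η`. -/
structure InWideQuadrant (η : ℝ) (α : Real.Angle) : Prop where
  sin_nonneg : 0 ≤ α.sin
  neg_le_cos : -η ≤ α.cos

theorem abs_toReal_lt_of_cos {α : Real.Angle} (hα : -(1 / 2) < α.cos) :
    |α.toReal| < 2 * Real.pi / 3 := by
  have hcos : Real.cos (2 * Real.pi / 3) = -(1 / 2) := by
    rw [show 2 * Real.pi / 3 = Real.pi - Real.pi / 3 by ring, Real.cos_pi_sub,
      Real.cos_pi_div_three]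
  by_contra! hle
  have := Real.cos_le_cos_of_nonneg_of_le_pi (by positivity) α.abs_toReal_le_pi hle
  rw [Real.cos_abs, Real.Angle.cos_toReal, hcos] at this
  linarith

theorem sin_sub_nonneg_of_toReal_le {α β : Real.Angle} (hα : -(1 / 2) < α.cos)
    (hβ : -(1 / 2) < β.cos) (hαβ : -(1 / 2) < (β - α).cos) (hle : α.toReal ≤ β.toReal) :
    0 ≤ (β - α).sin := by
  by_contra! hneg
  have hα' := (abs_lt.mp (abs_toReal_lt_of_cos hα)).1
  have hβ' := (abs_lt.mp (abs_toReal_lt_of_cos hβ)).2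
  have hγ := (abs_lt.mp (abs_toReal_lt_of_cos hαβ)).1
  have hγ0 : (β - α).toReal < 0 := Real.Angle.toReal_neg_iff_sign_neg.mpr (sign_neg hneg)
  have hcoe : ((β.toReal - α.toReal : ℝ) : Real.Angle) = ((β - α).toReal : ℝ) := by
    simp only [Real.Angle.coe_sub, Real.Angle.coe_toReal]
  obtain ⟨n, hn⟩ := Real.Angle.angle_eq_iff_two_pi_dvd_sub.mp hcoe
  have hn0 : (0 : ℝ) < n := pos_of_mul_pos_right (a := 2 * Real.pi) (by linarith) (by positivity)
  have hn1 : (n : ℝ) < 1 := by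
    refine lt_of_mul_lt_mul_left (a := 2 * Real.pi) ?_ (by positivity)
    linarith
  norm_cast at hn0 hn1
  lia

theorem mul_sum_filter_lt_le {ι : Type*} [Fintype ι] {w X : ι → ℝ} (hw : ∀ i, 0 ≤ w i)
    (hX : ∀ i, 0 ≤ X i) (t : ℝ) : t * ∑ i with t < X i, w i ≤ ∑ i, w i * X i :=
  calc t * ∑ i with t < X i, w i ≤ ∑ i with t < X i, w i * X i := by
        rw [mul_comm, sum_mul]
        exact sum_le_sum fun i hi => mul_le_mul_of_nonneg_left (mem_filter.mp hi).2.le (hw i)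
    _ ≤ ∑ i, w i * X i :=
        sum_le_sum_of_subset_of_nonneg (filter_subset _ _) fun i _ _ => mul_nonneg (hw i) (hX i)

/- All but a little weight lies in directions that make few obtuse angles. Fix one of them, `θ k`;
among those not obtuse to it, the one with least angle from `θ k` opens the quadrant, because three
directions that are pairwise less than `2 * π / 3` apart cannot wind around the circle. -/
theorem exists_wideQuadrant {ι : Type*} [Fintype ι] [DecidableEq ι] (θ : ι → Real.Angle)
    {w : ι → ℝ} {η t : ℝ} (hw : ∀ i, 0 ≤ w i) (hη0 : 0 ≤ η) (hη : η < 1 / 2) (ht : 0 < t)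
    (hO : ∑ i, w i * ∑ j with (θ i - θ j).cos < -η, w j ≤ t ^ 2) :
    ∃ (α : Real.Angle) (Q : Finset ι), (∀ i ∈ Q, InWideQuadrant η (θ i - α)) ∧
      ∑ i ∈ Qᶜ, w i ≤ 3 * t := by
  set O : ι → Finset ι := fun i => {j | (θ i - θ j).cos < -η}
  have hmemO {i j : ι} (hj : j ∉ O i) : -η ≤ (θ j - θ i).cos := by
    rw [← neg_sub, Real.Angle.cos_neg]
    simpa [O] using hj
  set B : Finset ι := {i | t < ∑ j ∈ O i, w j}
  have hB : ∑ i ∈ B, w i ≤ t := by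
    refine le_of_mul_le_mul_left ((mul_sum_filter_lt_le hw (fun i => ?_) t).trans ?_) ht
    · exact sum_nonneg fun j _ => hw j
    · rwa [← sq]
  have hO_le {i : ι} (hi : i ∉ B) : ∑ j ∈ O i, w j ≤ t := by simpa [B] using hi
  rcases Bᶜ.eq_empty_or_nonempty with hBe | ⟨k, hk⟩
  · refine ⟨0, ∅, by simp, ?_⟩
    rw [compl_eq_empty_iff] at hBe
    rw [compl_empty, ← hBe]
    linarith
  have hkB : k ∉ B := mem_compl.mp hk
  have hkk : k ∉ O k := by
    simp only [O, mem_filter_univ, sub_self, Real.Angle.cos_zero]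
    linarith
  obtain ⟨l, hl, hmin⟩ := exists_min_image (B ∪ O k)ᶜ (fun i => (θ i - θ k).toReal)
    ⟨k, by simp [hkB, hkk]⟩
  simp only [mem_compl, mem_union, not_or] at hl hmin
  refine ⟨θ l, (B ∪ O k ∪ O l)ᶜ, fun i hi => ?_, ?_⟩
  · simp only [mem_compl, mem_union, not_or] at hi
    have hik := hmemO hi.1.2
    have hlk := hmemO hl.2
    have hil := hmemO hi.2
    refine ⟨?_, hil⟩
    rw [← sub_sub_sub_cancel_right _ _ (θ k)] at hil ⊢
    exact sin_sub_nonneg_of_toReal_le (by linarith) (by linarith) (by linarith) (hmin i hi.1)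
  · have hunion (s t : Finset ι) : ∑ i ∈ s ∪ t, w i ≤ ∑ i ∈ s, w i + ∑ i ∈ t, w i := by
      rw [← sum_union_inter]
      exact le_add_of_nonneg_right (sum_nonneg fun i _ => hw i)
    rw [compl_compl]
    linarith [hunion (B ∪ O k) (O l), hunion B (O k), hO_le hkB, hO_le hl.1]

theorem sub_le_posPart_mul_posPart {η a b : ℝ} (hη0 : 0 ≤ η) (hη : η ≤ 1) (ha : -η ≤ a)
    (hb : -η ≤ b) : a * b - η ≤ a⁺ * b⁺ := by
  rcases le_total 0 a with ha0 | ha0 <;> rcases le_total 0 b with hb0 | hb0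
  · rw [posPart_eq_self.mpr ha0, posPart_eq_self.mpr hb0]
    linarith
  · rw [posPart_eq_zero.mpr hb0, mul_zero]
    linarith [mul_nonpos_of_nonneg_of_nonpos ha0 hb0]
  · rw [posPart_eq_zero.mpr ha0, zero_mul]
    linarith [mul_nonpos_of_nonpos_of_nonneg ha0 hb0]
  · rw [posPart_eq_zero.mpr ha0, zero_mul]
    nlinarith

theorem sub_le_posPart_sub_mul_posPart_sub {δ a b : ℝ} (hδ : 0 ≤ δ) (ha : 0 ≤ a) (ha1 : a ≤ 1)
    (hb : b ≤ 1) : a * b - 2 * δ ≤ (a - δ)⁺ * (b - δ)⁺ := by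
  rcases le_total a δ with haδ | haδ
  · rw [posPart_eq_zero.mpr (sub_nonpos.mpr haδ), zero_mul]
    nlinarith
  rcases le_total b δ with hbδ | hbδ
  · rw [posPart_eq_zero.mpr (sub_nonpos.mpr hbδ), mul_zero]
    nlinarith
  rw [posPart_eq_self.mpr (sub_nonneg.mpr haδ), posPart_eq_self.mpr (sub_nonneg.mpr hbδ)]
  nlinarith

theorem posPart_sub_mul_posPart_sub_le {δ a b : ℝ} (hδ : 0 ≤ δ) (ha : 0 ≤ a) (hb : 0 ≤ b) :
    (a - δ)⁺ * (b - δ)⁺ ≤ a * b :=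
  mul_le_mul (sup_le (sub_le_self a hδ) ha) (sup_le (sub_le_self b hδ) hb) (posPart_nonneg _) ha

theorem angle_cos_le_one (α : Real.Angle) : α.cos ≤ 1 := by
  rw [← α.cos_toReal]
  exact Real.cos_le_one _

theorem angle_sin_le_one (α : Real.Angle) : α.sin ≤ 1 := by
  rw [← α.sin_toReal]
  exact Real.sin_le_one _

theorem angle_cos_sub (α β : Real.Angle) :
    (α - β).cos = α.cos * β.cos + α.sin * β.sin := by
  rw [sub_eq_add_neg, Real.Angle.cos_add, Real.Angle.cos_neg, Real.Angle.sin_neg]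
  ring

/-- The unit vector in direction `α`, truncated to have nonnegative coordinates. The sine is first
lowered by `2 * η` so that, on a wide quadrant, the error made by truncating the cosines never
pushes an inner product above the original one. -/
noncomputable def quadrantVector (η : ℝ) (α : Real.Angle) : Fin 2 → ℝ :=
  ![α.cos⁺, (α.sin - 2 * η)⁺]

/-- An approximation of `cos (α - β)` on a wide quadrant which, unlike the cosine, is the inner
product of two vectors with nonnegative coordinates. -/
noncomputable def quadrantKernel (η : ℝ) (α β : Real.Angle) : ℝ :=
  quadrantVector η α ⬝ᵥ quadrantVector η β

theorem quadrantVector_nonneg (η : ℝ) (α : Real.Angle) (k : Fin 2) : 0 ≤ quadrantVector η α k := by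
  fin_cases k <;> exact posPart_nonneg _

theorem quadrantKernel_eq (η : ℝ) (α β : Real.Angle) :
    quadrantKernel η α β = α.cos⁺ * β.cos⁺ + (α.sin - 2 * η)⁺ * (β.sin - 2 * η)⁺ :=
  Matrix.vec2_dotProduct _ _

theorem quadrantKernel_comm (η : ℝ) (α β : Real.Angle) :
    quadrantKernel η α β = quadrantKernel η β α :=
  dotProduct_comm _ _

theorem quadrantKernel_nonneg (η : ℝ) (α β : Real.Angle) : 0 ≤ quadrantKernel η α β :=
  dotProduct_nonneg_of_nonneg (quadrantVector_nonneg η α) (quadrantVector_nonneg η β)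

variable {η : ℝ} {α β : Real.Angle}

theorem neg_le_cos_mul_cos (hα : InWideQuadrant η α) (hα0 : α.cos ≤ 0) (β : Real.Angle) :
    -η ≤ α.cos * β.cos := by
  have h : 0 ≤ (-α.cos) * (1 - β.cos) :=
    mul_nonneg (neg_nonneg.mpr hα0) (sub_nonneg.mpr (angle_cos_le_one β))
  linarith [hα.neg_le_cos]

theorem neg_le_cos_sub (hη0 : 0 ≤ η) (hα : InWideQuadrant η α) (hβ : InWideQuadrant η β) :
    -η ≤ (α - β).cos := by
  rw [angle_cos_sub]
  have hcos : -η ≤ α.cos * β.cos := by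
    rcases le_total α.cos 0 with hα0 | hα0
    · exact neg_le_cos_mul_cos hα hα0 β
    rcases le_total β.cos 0 with hβ0 | hβ0
    · rw [mul_comm]
      exact neg_le_cos_mul_cos hβ hβ0 α
    · linarith [mul_nonneg hα0 hβ0]
  linarith [mul_nonneg hα.sin_nonneg hβ.sin_nonneg]

theorem cos_sub_sub_le_quadrantKernel (hη0 : 0 ≤ η) (hη : η ≤ 1 / 4) (hα : InWideQuadrant η α)
    (hβ : InWideQuadrant η β) : (α - β).cos - 5 * η ≤ quadrantKernel η α β := by
  have hcos := sub_le_posPart_mul_posPart hη0 (by linarith) hα.neg_le_cos hβ.neg_le_cos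
  have hsin := sub_le_posPart_sub_mul_posPart_sub (mul_nonneg zero_le_two hη0) hα.sin_nonneg
    (angle_sin_le_one α) (angle_sin_le_one β)
  rw [angle_cos_sub, quadrantKernel_eq]
  linarith

theorem quadrantKernel_le_of_cos_nonpos (hη0 : 0 ≤ η) (hη : η ≤ 1 / 4) (hα : InWideQuadrant η α)
    (hβ : InWideQuadrant η β) (hα0 : α.cos ≤ 0) :
    quadrantKernel η α β = 0 ∨ quadrantKernel η α β ≤ (α - β).cos := by
  rw [angle_cos_sub, quadrantKernel_eq, posPart_eq_zero.mpr hα0, zero_mul, zero_add]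
  rcases le_total β.cos 0 with hβ0 | _
  · right
    linarith [mul_nonneg_of_nonpos_of_nonpos hα0 hβ0,
      posPart_sub_mul_posPart_sub_le (mul_nonneg zero_le_two hη0) hα.sin_nonneg hβ.sin_nonneg]
  rcases le_total β.sin (2 * η) with hβη | hβη
  · left
    rw [posPart_eq_zero.mpr (sub_nonpos.mpr hβη), mul_zero]
  right
  have hsin : 1 / 2 ≤ α.sin := by
    nlinarith [α.cos_sq_add_sin_sq, hα.neg_le_cos, hα.sin_nonneg]
  rw [posPart_eq_self.mpr (by linarith), posPart_eq_self.mpr (by linarith)]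
  calc (α.sin - 2 * η) * (β.sin - 2 * η)
      = α.sin * β.sin - 2 * η * α.sin - 2 * η * (β.sin - 2 * η) := by ring
    _ ≤ α.sin * β.sin - η := by
      linarith [mul_le_mul_of_nonneg_left hsin hη0, mul_nonneg hη0 (sub_nonneg.mpr hβη)]
    _ ≤ α.cos * β.cos + α.sin * β.sin := by linarith [neg_le_cos_mul_cos hα hα0 β]

theorem quadrantKernel_sq_le (hη0 : 0 ≤ η) (hη : η ≤ 1 / 4) (hα : InWideQuadrant η α)
    (hβ : InWideQuadrant η β) : quadrantKernel η α β ^ 2 ≤ (α - β).cos ^ 2 := by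
  have hupper : quadrantKernel η α β = 0 ∨ quadrantKernel η α β ≤ (α - β).cos := by
    rcases le_total α.cos 0 with hα0 | hα0
    · exact quadrantKernel_le_of_cos_nonpos hη0 hη hα hβ hα0
    rcases le_total β.cos 0 with hβ0 | hβ0
    · rw [quadrantKernel_comm, ← neg_sub, Real.Angle.cos_neg]
      exact quadrantKernel_le_of_cos_nonpos hη0 hη hβ hα hβ0
    · right
      rw [angle_cos_sub, quadrantKernel_eq, posPart_eq_self.mpr hα0, posPart_eq_self.mpr hβ0]
      exact add_le_add_right (posPart_sub_mul_posPart_sub_le (mul_nonneg zero_le_two hη0)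
        hα.sin_nonneg hβ.sin_nonneg) _
  rcases hupper with h | h
  · rw [h, zero_pow two_ne_zero]
    exact sq_nonneg _
  · exact pow_le_pow_left₀ (quadrantKernel_nonneg η α β) h 2

theorem sub_le_quadrantKernel_sq (hη0 : 0 ≤ η) (hη : η ≤ 1 / 4) (hα : InWideQuadrant η α)
    (hβ : InWideQuadrant η β) : (α - β).cos ^ 2 - 10 * η ≤ quadrantKernel η α β ^ 2 := by
  rcases le_total (α - β).cos (5 * η) with h | h
  · have := sq_le_sq' (by linarith [neg_le_cos_sub hη0 hα hβ]) h
    nlinarith [sq_nonneg (quadrantKernel η α β)]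
  · have := pow_le_pow_left₀ (sub_nonneg.mpr h) (cos_sub_sub_le_quadrantKernel hη0 hη hα hβ) 2
    nlinarith [angle_cos_le_one (α - β)]

end WideQuadrant

section QuadrantEstimate

theorem one_le_cliqueNum {V : Type*} [Finite V] [Nonempty V] (G : SimpleGraph V) :
    1 ≤ G.cliqueNum := by
  obtain ⟨v⟩ := ‹Nonempty V›
  simpa using SimpleGraph.IsClique.card_le_cliqueNum (G := G) (t := {v}) (tc := by simp)

variable {V : Type*} [Fintype V]

theorem sq_inner_eq_norm_mul_cos_sq (z w : ℂ) (α : Real.Angle) :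
    inner ℝ z w ^ 2 = (‖z‖ * ‖w‖) ^ 2 * ((z.arg - α : Real.Angle) - (w.arg - α)).cos ^ 2 := by
  rw [real_inner_eq_norm_mul_cos_arg_sub, mul_pow, sub_sub_sub_cancel_right]

theorem sum_product_sq_inner_le (G : SimpleGraph V) [DecidableRel G.Adj] {z : V → ℂ}
    {Q : Finset V} {η : ℝ} {α : Real.Angle} (hη0 : 0 ≤ η) (hη : η ≤ 1 / 4)
    (hQ : ∀ i ∈ Q, InWideQuadrant η ((z i).arg - α)) :
    ∑ p ∈ Q ×ˢ Q, inner ℝ (z p.1) (z p.2) ^ 2 ≤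
      G.cliqueNum * ∑ p : V × V with ¬ G.Adj p.1 p.2, inner ℝ (z p.1) (z p.2) ^ 2 +
        10 * η * (∑ i, ‖z i‖ ^ 2) ^ 2 := by
  classical
  set θ : V → Real.Angle := fun i => (z i).arg - α
  set x : V → Fin 2 → ℝ := fun i => if i ∈ Q then ‖z i‖ • quadrantVector η (θ i) else 0
  have hx (i : V) (k : Fin 2) : 0 ≤ x i k := by
    simp only [x]
    split_ifs
    exacts [mul_nonneg (norm_nonneg _) (quadrantVector_nonneg _ _ _), le_rfl]
  have hdot (i j : V) : x i ⬝ᵥ x j =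
      if i ∈ Q ∧ j ∈ Q then ‖z i‖ * ‖z j‖ * quadrantKernel η (θ i) (θ j) else 0 := by
    by_cases hi : i ∈ Q <;> by_cases hj : j ∈ Q <;>
      simp [x, hi, hj, quadrantKernel, mul_assoc, mul_left_comm]
  have hupper (i j : V) : (x i ⬝ᵥ x j) ^ 2 ≤ inner ℝ (z i) (z j) ^ 2 := by
    rw [hdot, sq_inner_eq_norm_mul_cos_sq (z i) (z j) α]
    split_ifs with hij
    · rw [mul_pow]
      exact mul_le_mul_of_nonneg_left
        (quadrantKernel_sq_le hη0 hη (hQ i hij.1) (hQ j hij.2)) (sq_nonneg _)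
    · rw [zero_pow two_ne_zero]
      positivity
  have hlower (i j : V) (hi : i ∈ Q) (hj : j ∈ Q) :
      inner ℝ (z i) (z j) ^ 2 ≤ (x i ⬝ᵥ x j) ^ 2 + 10 * η * (‖z i‖ ^ 2 * ‖z j‖ ^ 2) := by
    rw [hdot, if_pos ⟨hi, hj⟩, sq_inner_eq_norm_mul_cos_sq (z i) (z j) α]
    linarith [mul_le_mul_of_nonneg_left
      (sub_le_quadrantKernel_sq hη0 hη (hQ i hi) (hQ j hj)) (sq_nonneg (‖z i‖ * ‖z j‖))]
  calc ∑ p ∈ Q ×ˢ Q, inner ℝ (z p.1) (z p.2) ^ 2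
      ≤ ∑ p ∈ Q ×ˢ Q, ((x p.1 ⬝ᵥ x p.2) ^ 2 + 10 * η * (‖z p.1‖ ^ 2 * ‖z p.2‖ ^ 2)) :=
        sum_le_sum fun p hp => hlower _ _ (mem_product.mp hp).1 (mem_product.mp hp).2
    _ ≤ ∑ p : V × V, ((x p.1 ⬝ᵥ x p.2) ^ 2 + 10 * η * (‖z p.1‖ ^ 2 * ‖z p.2‖ ^ 2)) :=
        sum_le_sum_of_subset_of_nonneg (subset_univ _) fun _ _ _ => by positivity
    _ = ∑ p : V × V, (x p.1 ⬝ᵥ x p.2) ^ 2 + 10 * η * (∑ i, ‖z i‖ ^ 2) ^ 2 := by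
        rw [sum_add_distrib, ← mul_sum, sq (∑ i, _), sum_mul_sum, ← Fintype.sum_prod_type']
    _ ≤ _ := by
        gcongr ?_ + _
        refine (sum_sq_dotProduct_le_cliqueNum_mul G hx).trans ?_
        exact mul_le_mul_of_nonneg_left (sum_le_sum fun p _ => hupper _ _) (Nat.cast_nonneg _)

theorem sum_sq_inner_le_sum_product_add [DecidableEq V] (z : V → ℂ) (Q : Finset V) :
    ∑ p : V × V, inner ℝ (z p.1) (z p.2) ^ 2 ≤
      ∑ p ∈ Q ×ˢ Q, inner ℝ (z p.1) (z p.2) ^ 2 +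
        2 * (∑ i, ‖z i‖ ^ 2) * ∑ i ∈ Qᶜ, ‖z i‖ ^ 2 := by
  have hle (s t : Finset V) : ∑ i ∈ s, ∑ j ∈ t, inner ℝ (z i) (z j) ^ 2 ≤
      (∑ i ∈ s, ‖z i‖ ^ 2) * ∑ j ∈ t, ‖z j‖ ^ 2 := by
    rw [sum_mul_sum]
    exact sum_le_sum fun i _ => sum_le_sum fun j _ => sq_inner_le _ _
  have hQ : (∑ i ∈ Q, ‖z i‖ ^ 2) * ∑ i ∈ Qᶜ, ‖z i‖ ^ 2 ≤
      (∑ i, ‖z i‖ ^ 2) * ∑ i ∈ Qᶜ, ‖z i‖ ^ 2 :=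
    mul_le_mul_of_nonneg_right
      (sum_le_sum_of_subset_of_nonneg (subset_univ Q) fun _ _ _ => sq_nonneg _)
      (sum_nonneg fun _ _ => sq_nonneg _)
  calc ∑ p : V × V, inner ℝ (z p.1) (z p.2) ^ 2
      = ∑ p ∈ Q ×ˢ Q, inner ℝ (z p.1) (z p.2) ^ 2 +
          ∑ i ∈ Q, ∑ j ∈ Qᶜ, inner ℝ (z i) (z j) ^ 2 +
          ∑ i ∈ Qᶜ, ∑ j, inner ℝ (z i) (z j) ^ 2 := by
        rw [Fintype.sum_prod_type, sum_product, ← sum_add_distrib, ← sum_add_sum_compl Q]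
        simp only [sum_add_sum_compl]
    _ ≤ _ := by linarith [hle Q Qᶜ, hle Qᶜ univ]

theorem sq_mul_sq_norm_mul_le_negPart_inner_sq {z w : ℂ} {η : ℝ} (hη : 0 ≤ η)
    (h : ((z.arg : Real.Angle) - w.arg).cos < -η) :
    η ^ 2 * (‖z‖ ^ 2 * ‖w‖ ^ 2) ≤ (inner ℝ z w)⁻ ^ 2 := by
  rw [← mul_pow, ← mul_pow]
  refine pow_le_pow_left₀ (by positivity) (le_trans ?_ (neg_le_negPart _)) 2
  rw [real_inner_eq_norm_mul_cos_arg_sub]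
  linarith [mul_le_mul_of_nonneg_left h.le (by positivity : 0 ≤ ‖z‖ * ‖w‖)]

theorem sum_mul_sum_norm_sq_le {z : V → ℂ} {η t : ℝ} (hη : 0 < η)
    (h : ∑ p : V × V, (inner ℝ (z p.1) (z p.2))⁻ ^ 2 ≤ (η * t) ^ 2) :
    ∑ i, ‖z i‖ ^ 2 * ∑ j with (((z i).arg : Real.Angle) - (z j).arg).cos < -η, ‖z j‖ ^ 2 ≤
      t ^ 2 := by
  refine le_of_mul_le_mul_left ?_ (pow_pos hη 2)
  rw [← mul_pow]
  refine le_trans ?_ h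
  simp only [mul_sum, Fintype.sum_prod_type]
  refine sum_le_sum fun i _ => ?_
  rw [sum_filter]
  refine sum_le_sum fun j _ => ?_
  split_ifs with hij
  · exact sq_mul_sq_norm_mul_le_negPart_inner_sq hη.le hij
  · exact sq_nonneg _

theorem sum_sq_inner_le_cliqueNum_mul_add (G : SimpleGraph V) [DecidableRel G.Adj]
    {z : V → ℂ} {η t : ℝ} (hη0 : 0 < η) (hη : η ≤ 1 / 4) (ht : 0 < t)
    (h : ∑ p : V × V, (inner ℝ (z p.1) (z p.2))⁻ ^ 2 ≤ (η * t) ^ 2) :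
    ∑ p : V × V, inner ℝ (z p.1) (z p.2) ^ 2 ≤
      G.cliqueNum * ∑ p : V × V with ¬ G.Adj p.1 p.2, inner ℝ (z p.1) (z p.2) ^ 2 +
        10 * η * (∑ i, ‖z i‖ ^ 2) ^ 2 + 6 * t * ∑ i, ‖z i‖ ^ 2 := by
  classical
  obtain ⟨α, Q, hQ, hQc⟩ := exists_wideQuadrant (fun i => ((z i).arg : Real.Angle))
    (fun i => sq_nonneg ‖z i‖) hη0.le (by linarith) ht (sum_mul_sum_norm_sq_le hη0 h)
  have hP : 0 ≤ ∑ i, ‖z i‖ ^ 2 := sum_nonneg fun i _ => sq_nonneg _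
  linarith [sum_sq_inner_le_sum_product_add z Q, sum_product_sq_inner_le G hη0.le hη hQ,
    mul_le_mul_of_nonneg_left hQc hP]

theorem sum_negPart_sq_le (G : SimpleGraph V) [DecidableRel G.Adj] (f : V × V → ℝ) :
    ∑ p, (f p)⁻ ^ 2 ≤
      ∑ p with ¬ G.Adj p.1 p.2, f p ^ 2 + ∑ p with G.Adj p.1 p.2, (f p)⁻ ^ 2 := by
  rw [← sum_filter_not_add_sum_filter univ fun p : V × V => G.Adj p.1 p.2]
  gcongr ?_ + _
  refine sum_le_sum fun p _ => sq_le_sq.mpr ?_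
  rw [abs_of_nonneg (negPart_nonneg _)]
  exact sup_le (neg_le_abs _) (abs_nonneg _)

theorem one_sub_mul_sum_sq_inner_le (G : SimpleGraph V) [DecidableRel G.Adj] (z : V → ℂ) {h : ℝ}
    (h0 : 0 < h) (h1 : h ≤ 1 / 50) (hh : G.cliqueNum * h ^ 6 = 1) :
    (1 - 25 * h) * ∑ p : V × V, inner ℝ (z p.1) (z p.2) ^ 2 ≤
      G.cliqueNum *
        (∑ p : V × V with ¬ G.Adj p.1 p.2, inner ℝ (z p.1) (z p.2) ^ 2 +
          ∑ p : V × V with G.Adj p.1 p.2, (inner ℝ (z p.1) (z p.2))⁻ ^ 2) := by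
  have hneg := sum_negPart_sq_le G fun p => inner ℝ (z p.1) (z p.2)
  have hmain := sum_sq_inner_le_cliqueNum_mul_add G (z := z) (t := h ^ 2 * ∑ i, ‖z i‖ ^ 2) h0
    (by linarith)
  have hSP := sum_sq_inner_le z
  have hPS := sq_sum_norm_sq_le z
  have hS : 0 ≤ ∑ p : V × V, inner ℝ (z p.1) (z p.2) ^ 2 := sum_nonneg fun _ _ => sq_nonneg _
  have hP : 0 ≤ ∑ i, ‖z i‖ ^ 2 := sum_nonneg fun _ _ => sq_nonneg _
  have hD : 0 ≤ ∑ p : V × V with ¬ G.Adj p.1 p.2, inner ℝ (z p.1) (z p.2) ^ 2 :=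
    sum_nonneg fun _ _ => sq_nonneg _
  have hR : 0 ≤ ∑ p : V × V with G.Adj p.1 p.2, (inner ℝ (z p.1) (z p.2))⁻ ^ 2 :=
    sum_nonneg fun _ _ => sq_nonneg _
  set S : ℝ := ∑ p : V × V, inner ℝ (z p.1) (z p.2) ^ 2
  set P : ℝ := ∑ i, ‖z i‖ ^ 2
  set D : ℝ := ∑ p : V × V with ¬ G.Adj p.1 p.2, inner ℝ (z p.1) (z p.2) ^ 2
  set R : ℝ := ∑ p : V × V with G.Adj p.1 p.2, (inner ℝ (z p.1) (z p.2))⁻ ^ 2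
  have hω : (0 : ℝ) ≤ G.cliqueNum := Nat.cast_nonneg _
  have hSh : 0 ≤ h * S := mul_nonneg h0.le hS
  rcases hP.eq_or_lt with hP0 | hP0
  · have hS0 : S = 0 := le_antisymm (by simpa [← hP0] using hSP) hS
    rw [hS0, mul_zero]
    exact mul_nonneg hω (add_nonneg hD hR)
  rcases le_total S (G.cliqueNum * (D + R)) with hle | hle
  · linarith
  have hDR : D + R ≤ (h * (h ^ 2 * P)) ^ 2 :=
    calc D + R = h ^ 6 * (G.cliqueNum * (D + R)) := by linear_combination -(D + R) * hh
      _ ≤ h ^ 6 * P ^ 2 := by gcongr; exact hle.trans hSP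
      _ = (h * (h ^ 2 * P)) ^ 2 := by ring
  have herror : 10 * h * P ^ 2 + 6 * (h ^ 2 * P) * P ≤ 25 * h * S := by
    have hsq : h * (h * P ^ 2) ≤ 1 / 50 * (h * P ^ 2) := by gcongr
    linarith [mul_le_mul_of_nonneg_left hPS h0.le]
  linarith [hmain (by positivity) (hneg.trans hDR), mul_nonneg hω hR]

theorem sum_sq_inner_le_mul (G : SimpleGraph V) [DecidableRel G.Adj] (z : V → ℂ) {h : ℝ}
    (h0 : 0 < h) (hh : G.cliqueNum * h ^ 6 = 1) :
    ∑ p : V × V, inner ℝ (z p.1) (z p.2) ^ 2 ≤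
      G.cliqueNum * (1 + 50 * h) *
        (∑ p : V × V with ¬ G.Adj p.1 p.2, inner ℝ (z p.1) (z p.2) ^ 2 +
          ∑ p : V × V with G.Adj p.1 p.2, (inner ℝ (z p.1) (z p.2))⁻ ^ 2) := by
  rcases le_total h (1 / 50) with hsmall | hlarge
  · have hgain : 1 ≤ (1 + 50 * h) * (1 - 25 * h) := by
      linarith [mul_nonneg h0.le (sub_nonneg.mpr hsmall)]
    have hS : 0 ≤ ∑ p : V × V, inner ℝ (z p.1) (z p.2) ^ 2 := sum_nonneg fun _ _ => sq_nonneg _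
    have h50 : 0 ≤ 1 + 50 * h := by positivity
    linarith [mul_le_mul_of_nonneg_right hgain hS,
      mul_le_mul_of_nonneg_left (one_sub_mul_sum_sq_inner_le G z h0 hsmall hh) h50]
  · refine (sum_sq_inner_le_two_mul_cliqueNum_mul G z).trans ?_
    rw [mul_comm (2 : ℝ)]
    gcongr
    · linarith
    · exact le_add_of_nonneg_right (sum_nonneg fun _ _ => sq_nonneg _)

theorem sum_sq_inner_le_rpow_mul [Nonempty V] (G : SimpleGraph V) [DecidableRel G.Adj]
    (z : V → ℂ) :
    ∑ p : V × V, inner ℝ (z p.1) (z p.2) ^ 2 ≤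
      (G.cliqueNum + 50 * (G.cliqueNum : ℝ) ^ ((5 : ℝ) / 6)) *
        (∑ p : V × V with ¬ G.Adj p.1 p.2, inner ℝ (z p.1) (z p.2) ^ 2 +
          ∑ p : V × V with G.Adj p.1 p.2, (inner ℝ (z p.1) (z p.2))⁻ ^ 2) := by
  have hω : (0 : ℝ) < G.cliqueNum := by exact_mod_cast one_le_cliqueNum G
  have hpow : (G.cliqueNum : ℝ) * ((G.cliqueNum : ℝ) ^ (-(1 / 6) : ℝ)) ^ 6 = 1 := by
    have h16 : (-(1 / 6) : ℝ) * (6 : ℕ) = -1 := by norm_num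
    rw [← Real.rpow_mul_natCast hω.le, h16, Real.rpow_neg_one, mul_inv_cancel₀ hω.ne']
  have hmul : (G.cliqueNum : ℝ) * (1 + 50 * (G.cliqueNum : ℝ) ^ (-(1 / 6) : ℝ)) =
      G.cliqueNum + 50 * (G.cliqueNum : ℝ) ^ ((5 : ℝ) / 6) := by
    have h56 : (5 / 6 : ℝ) = 1 + -(1 / 6) := by norm_num
    rw [h56, Real.rpow_add hω, Real.rpow_one]
    ring
  rw [← hmul]
  exact sum_sq_inner_le_mul G z (Real.rpow_pos_of_pos hω _) hpow

end QuadrantEstimate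

section Spectrum

variable {V : Type*} [Fintype V] (G : SimpleGraph V) [DecidableRel G.Adj]

theorem sq_eq_posPart_sq_add_negPart_sq (a : ℝ) : a ^ 2 = a⁺ ^ 2 + a⁻ ^ 2 := by
  rcases le_total 0 a with ha | ha
  · rw [posPart_eq_self.mpr ha, negPart_eq_zero.mpr ha]
    ring
  · rw [posPart_eq_zero.mpr ha, negPart_eq_neg.mpr ha]
    ring

theorem sum_sq_le_one_sub_inv_mul {f : V × V → ℝ} {W : ℝ} (hW : 1 ≤ W)
    (hf : ∑ p, f p ^ 2 ≤ ∑ p with G.Adj p.1 p.2, f p)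
    (hfW : ∑ p, f p ^ 2 ≤
      W * (∑ p with ¬ G.Adj p.1 p.2, f p ^ 2 + ∑ p with G.Adj p.1 p.2, (f p)⁻ ^ 2)) :
    ∑ p, f p ^ 2 ≤ (1 - 1 / W) * (2 * (#G.edgeFinset : ℝ)) := by
  have hsplit : ∑ p, f p ^ 2 = ∑ p with G.Adj p.1 p.2, (f p)⁺ ^ 2 +
      (∑ p with ¬ G.Adj p.1 p.2, f p ^ 2 + ∑ p with G.Adj p.1 p.2, (f p)⁻ ^ 2) := by
    rw [← sum_filter_add_sum_filter_not univ fun p : V × V => G.Adj p.1 p.2, add_left_comm,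
      ← sum_add_distrib, add_comm]
    simp only [← sq_eq_posPart_sq_add_negPart_sq]
  have hS : 0 ≤ ∑ p, f p ^ 2 := sum_nonneg fun p _ => sq_nonneg _
  have hcs : (∑ p, f p ^ 2) ^ 2 ≤
      2 * (#G.edgeFinset : ℝ) * ∑ p with G.Adj p.1 p.2, (f p)⁺ ^ 2 :=
    calc (∑ p, f p ^ 2) ^ 2 ≤ (∑ p with G.Adj p.1 p.2, (f p)⁺) ^ 2 :=
          pow_le_pow_left₀ hS (hf.trans (sum_le_sum fun p _ => le_posPart _)) 2
      _ ≤ _ := sq_sum_le_card_mul_sum_sq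
      _ = _ := by
          congr 1
          exact_mod_cast G.two_mul_card_edgeFinset.symm
  set S := ∑ p, f p ^ 2
  set N := ∑ p with ¬ G.Adj p.1 p.2, f p ^ 2 + ∑ p with G.Adj p.1 p.2, (f p)⁻ ^ 2
  set m := 2 * (#G.edgeFinset : ℝ)
  have hW0 : 0 < W := zero_lt_one.trans_le hW
  have hm : 0 ≤ m := by positivity
  rcases hS.eq_or_lt with hS0 | hS0
  · rw [← hS0]
    exact mul_nonneg (sub_nonneg.mpr ((div_le_one hW0).mpr hW)) hm
  have hN : S / W ≤ N := (div_le_iff₀' hW0).mpr hfW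
  refine le_of_mul_le_mul_right ?_ hS0
  calc S * S ≤ m * (S - N) := by
        rw [← sq, hsplit, add_sub_cancel_right, ← hsplit]
        exact hcs
    _ ≤ m * (S - S / W) := by gcongr
    _ = (1 - 1 / W) * m * S := by ring

theorem sum_adj_mul (x : V → ℝ) :
    ∑ p : V × V with G.Adj p.1 p.2, x p.1 * x p.2 = x ⬝ᵥ G.adjMatrix ℝ *ᵥ x := by
  rw [SimpleGraph.dotProduct_mulVec_adjMatrix, sum_filter, Fintype.sum_prod_type]

theorem add_sq_le_of_orthonormal [Nonempty V] {x y : V → ℝ} {l m : ℝ}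
    (hl : 0 ≤ l) (hm : 0 ≤ m) (hxx : x ⬝ᵥ x = 1) (hyy : y ⬝ᵥ y = 1) (hxy : x ⬝ᵥ y = 0)
    (hx : G.adjMatrix ℝ *ᵥ x = l • x) (hy : G.adjMatrix ℝ *ᵥ y = m • y) :
    l ^ 2 + m ^ 2 ≤ (1 - 1 / (G.cliqueNum + 50 * (G.cliqueNum : ℝ) ^ ((5 : ℝ) / 6))) *
      (2 * (#G.edgeFinset : ℝ)) := by
  set z : V → ℂ := fun i => ⟨√l * x i, √m * y i⟩
  have hinner (i j : V) : inner ℝ (z i) (z j) = l * (x i * x j) + m * (y i * y j) := by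
    rw [real_inner_eq_re_mul_add_im_mul]
    linear_combination x i * x j * Real.mul_self_sqrt hl + y i * y j * Real.mul_self_sqrt hm
  have hre : ∑ i, (z i).re ^ 2 = l := by
    calc ∑ i, (z i).re ^ 2 = √l ^ 2 * x ⬝ᵥ x := by
          simp only [z, mul_pow, dotProduct, mul_sum, ← sq]
      _ = l := by rw [hxx, Real.sq_sqrt hl, mul_one]
  have him : ∑ i, (z i).im ^ 2 = m := by
    calc ∑ i, (z i).im ^ 2 = √m ^ 2 * y ⬝ᵥ y := by
          simp only [z, mul_pow, dotProduct, mul_sum, ← sq]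
      _ = m := by rw [hyy, Real.sq_sqrt hm, mul_one]
  have hreim : ∑ i, (z i).re * (z i).im = 0 := by
    calc ∑ i, (z i).re * (z i).im = √l * √m * x ⬝ᵥ y := by
          simp only [z, dotProduct, mul_sum, mul_mul_mul_comm]
      _ = 0 := by rw [hxy, mul_zero]
  have hsum : ∑ p : V × V, inner ℝ (z p.1) (z p.2) ^ 2 = l ^ 2 + m ^ 2 := by
    rw [sum_sq_inner, hre, him, hreim]
    ring
  have hadj : ∑ p : V × V with G.Adj p.1 p.2, inner ℝ (z p.1) (z p.2) = l ^ 2 + m ^ 2 := by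
    simp only [hinner, sum_add_distrib, ← mul_sum]
    rw [sum_adj_mul, sum_adj_mul, hx, hy, dotProduct_smul, dotProduct_smul, hxx, hyy]
    simp only [smul_eq_mul, mul_one, sq]
  have hω : (1 : ℝ) ≤ G.cliqueNum := by exact_mod_cast one_le_cliqueNum G
  rw [← hsum]
  refine sum_sq_le_one_sub_inv_mul G ?_ (by rw [hsum, hadj]) (sum_sq_inner_le_rpow_mul G z)
  exact le_add_of_le_of_nonneg hω (by positivity)

theorem inner_apply_le_eigenvalues_mul {E : Type*} [NormedAddCommGroup E] [InnerProductSpace ℝ E]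
    [FiniteDimensional ℝ E] {T : E →ₗ[ℝ] E} (hT : T.IsSymmetric) {n : ℕ}
    (hn : Module.finrank ℝ E = n) {k : Fin n} {z : E}
    (hz : ∀ i < k, inner ℝ (hT.eigenvectorBasis hn i) z = 0) :
    inner ℝ z (T z) ≤ hT.eigenvalues hn k * ‖z‖ ^ 2 := by
  set b := hT.eigenvectorBasis hn
  have hterm (i : Fin n) : inner ℝ z (b i) * inner ℝ (b i) (T z) =
      hT.eigenvalues hn i * inner ℝ (b i) z ^ 2 := by
    rw [← hT, hT.apply_eigenvectorBasis, real_inner_comm, inner_smul_left, RCLike.conj_to_real]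
    simp only [b, RCLike.ofReal_real_eq_id, id]
    ring
  rw [← b.sum_inner_mul_inner, ← b.sum_sq_inner_right, mul_sum]
  refine sum_le_sum fun i _ => (hterm i).trans_le ?_
  rcases lt_or_ge i k with hik | hki
  · rw [hz i hik]
    simp
  · exact mul_le_mul_of_nonneg_right (hT.eigenvalues_antitone hn hki) (sq_nonneg _)

variable [DecidableEq V]

theorem inner_single_toEuclideanLin_single (A : Matrix V V ℝ) (i j : V) :
    inner ℝ (EuclideanSpace.single i 1) (A.toEuclideanLin (EuclideanSpace.single j 1)) = A i j := by
  simp [EuclideanSpace.inner_single_left]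

variable {G} in
theorem adjEigenvalue_one_nonneg (hG : G ≠ ⊤) :
    0 ≤ G.adjEigenvalue ⟨1, SimpleGraph.one_lt_card_of_ne_top hG⟩ := by
  obtain ⟨u, v, huv, hadj⟩ := SimpleGraph.ne_top_iff_exists_not_adj.mp hG
  have hT := Matrix.isSymmetric_toEuclideanLin_iff.mpr (G.isHermitian_adjMatrix ℝ)
  set x := hT.eigenvectorBasis finrank_euclideanSpace
    ⟨0, zero_lt_one.trans (SimpleGraph.one_lt_card_of_ne_top hG)⟩
  obtain ⟨a, b, hab, hx⟩ : ∃ a b : ℝ, (a ≠ 0 ∨ b ≠ 0) ∧ a * x u + b * x v = 0 := by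
    by_cases h : x u = 0
    · exact ⟨1, 0, by simp, by simp [h]⟩
    · exact ⟨x v, -x u, by simp [h], by ring⟩
  set z : EuclideanSpace ℝ V := a • EuclideanSpace.single u 1 + b • EuclideanSpace.single v 1
  have hz : z ≠ 0 := by
    intro h
    have hu : a = 0 := by simpa [z, huv] using congrArg (fun w : EuclideanSpace ℝ V => w u) h
    have hv : b = 0 := by simpa [z, huv.symm] using congrArg (fun w : EuclideanSpace ℝ V => w v) h
    tauto
  have hform : inner ℝ z ((G.adjMatrix ℝ).toEuclideanLin z) = 0 := by
    simp only [z, map_add, map_smul, inner_add_left, inner_add_right, real_inner_smul_left,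
      real_inner_smul_right, inner_single_toEuclideanLin_single]
    simp [hadj, G.adj_comm v u]
  have hle := inner_apply_le_eigenvalues_mul hT finrank_euclideanSpace
    (k := ⟨1, SimpleGraph.one_lt_card_of_ne_top hG⟩) (z := z) fun i hi => ?_
  · rw [hform] at hle
    exact nonneg_of_mul_nonneg_left hle (by positivity)
  · obtain rfl : i = ⟨0, zero_lt_one.trans (SimpleGraph.one_lt_card_of_ne_top hG)⟩ :=
      Fin.ext (Nat.lt_one_iff.mp hi)
    simpa [z, inner_add_right, real_inner_smul_right, EuclideanSpace.inner_single_right] using hx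

end Spectrum

end BollobasNikiforov

theorem theorem3 {V : Type*} [Fintype V] [DecidableEq V] (G : SimpleGraph V)
    [DecidableRel G.Adj] (hG : G ≠ ⊤) :
    G.adjEigenvalue ⟨0, zero_lt_one.trans (SimpleGraph.one_lt_card_of_ne_top hG)⟩ ^ 2 +
        G.adjEigenvalue ⟨1, SimpleGraph.one_lt_card_of_ne_top hG⟩ ^ 2 ≤
      (1 - 1 / ((G.cliqueNum : ℝ) + 50 * (G.cliqueNum : ℝ) ^ ((5 : ℝ) / 6))) *
        (2 * (G.edgeFinset.card : ℝ)) := by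
  have hcard := SimpleGraph.one_lt_card_of_ne_top hG
  have : Nonempty V := Fintype.card_pos_iff.mp (zero_lt_one.trans hcard)
  have h1 := BollobasNikiforov.adjEigenvalue_one_nonneg hG
  have h0 : 0 ≤ G.adjEigenvalue ⟨0, zero_lt_one.trans hcard⟩ :=
    h1.trans ((G.isHermitian_adjMatrix ℝ).eigenvalues₀_antitone (by simp))
  have hT := Matrix.isSymmetric_toEuclideanLin_iff.mpr (G.isHermitian_adjMatrix ℝ)
  set b := hT.eigenvectorBasis finrank_euclideanSpace
  have hinner (i j) : (b i).ofLp ⬝ᵥ (b j).ofLp = if i = j then 1 else 0 := by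
    rw [← orthonormal_iff_ite.mp b.orthonormal, real_inner_comm]
    rfl
  have heigen (i) : (G.adjMatrix ℝ).mulVec (b i) = G.adjEigenvalue i • (b i).ofLp :=
    congrArg WithLp.ofLp (hT.apply_eigenvectorBasis finrank_euclideanSpace i)
  exact BollobasNikiforov.add_sq_le_of_orthonormal G h0 h1 (by simp [hinner]) (by simp [hinner])
    (by simp [hinner]) (heigen _) (heigen _)
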